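/- Let $k$ be a commutative ring with identity and let $b\in k$, $b\neq 0$. Algebras are associative $k$-algebras, not necessarily with identity. A para-differential Rota-Baxter algebra of type III (with parameter $b$) is an algebra $R$ with $k$-linear operators $d,P:R\to R$ such that, for all $x,y\in R$, $$d(xy)=d(x)y+x\,d(y),\qquad P(x)P(y)=P(P(x)y)+P(xP(y)),\qquad d(P(x))=P(d(x))+bP(x).$$ Let $X$ be a set and let $\Delta(X)=\{D^n(x)\mid x\in X,\ n\ge 0\}$ (with $D^0(x)=x$) be a set of distinct symbols. Let $\mathfrak X_\infty$ be the set of differential Rota-Baxter bracketed words on $X$, that is, the smallest set of nonempty words whose letters are the elements of $\Delta(X)$ and the symbols $P(w)$ with $w\in\mathfrak X_\infty$, no two letters of the form $P(w)$ being adjacent. Let $k\mathfrak X_\infty$ be the free $k$-module on $\mathfrak X_\infty$, with the following operations. * The bilinear product $\diamond$: for words $u=u'a$ and $v=cv'$ with last letter $a$ and first letter $c$, put $u\diamond v=u'(a\diamond c)v'$, where $a\diamond c=P\big(w\diamond P(w')\big)+P\big(P(w)\diamond w'\big)$ if $a=P(w)$ and $c=P(w')$, and $a\diamond c=ac$ (concatenation)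 otherwise. * The linear operator $P_{\mathfrak X}$ with $P_{\mathfrak X}(u)=P(u)$ for $u\in\mathfrak X_\infty$. * The linear operator $d_X$ with $d_X(D^n(x))=D^{n+1}(x)$, $d_X(P(u))=P_{\mathfrak X}(d_X(u))+bP(u)$ and, for a word $u_1u_2\cdots u_m$ with letters $u_i$ and $m\ge2$, $d_X(u_1u_2\cdots u_m)=d_X(u_1)\,u_2\cdots u_m+u_1\,d_X(u_2\cdots u_m)$, where products are concatenations. Then $(k\mathfrak X_\infty,\diamond,d_X,P_{\mathfrak X})$ is a para-differential Rota-Baxter algebra of type III with parameter $b$, the map $j_X:X\to k\mathfrak X_\infty$, $x\mapsto x$, is injective, and $(k\mathfrak X_\infty,\diamond,d_X,P_{\mathfrak X})$ together with $j_X$ is the free para-differential Rota-Baxter algebra of type III with parameter $b$ on $X$: for every para-differential Rota-Baxter algebra $(R,d,P)$ of type III with parameter $b$ and every map $f:X\to R$ there is a unique algebra homomorphism $F:k\mathfrak X_\infty\to R$ with $F\circ d_X=d\circ F$, $F\circ P_{\mathfrak X}=P\circ F$ and $F\circ j_X=f$. -/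

import Mathlib

/-! Free (noncommutative, nonunitary) para-differential Rota-Baxter algebras of type III. -/

universe u v w

/-- A differential operator of weight `lam` on a (nonunitary) `k`-algebra. -/
def IsDifferentialOperator {k : Type*} [CommRing k] {R : Type*} [NonUnitalNonAssocRing R]
    [Module k R] (lam : k) (d : R →ₗ[k] R) : Prop :=
  ∀ x y : R, d (x * y) = d x * y + x * d y + lam • (d x * d y)

/-- A Rota-Baxter operator of weight `lam` on a (nonunitary) `k`-algebra. -/
def IsRotaBaxterOperator {k : Type*} [CommRing k] {R : Type*} [NonUnitalNonAssocRing R]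
    [Module k R] (lam : k) (P : R →ₗ[k] R) : Prop :=
  ∀ x y : R, P x * P y = P (P x * y) + P (x * P y) + lam • P (x * y)

/-- The operators `d`, `P` make the `k`-algebra `R` (associative, not necessarily with identity) a
para-differential Rota-Baxter algebra of type III with parameter `b`: both operators have weight
`0`, and `dP = Pd + bP` with `b ≠ 0`. -/
structure IsParaDiffRotaBaxterIII {k : Type*} [CommRing k] (b : k) {R : Type*}
    [NonUnitalNonAssocRing R] [Module k R] (d P : R →ₗ[k] R) : Prop where
  smul_mul : ∀ (c : k) (x y : R), (c • x) * y = c • (x * y)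
  mul_smul : ∀ (c : k) (x y : R), x * (c • y) = c • (x * y)
  mul_assoc : ∀ x y z : R, (x * y) * z = x * (y * z)
  differential : IsDifferentialOperator (0 : k) d
  rotaBaxter : IsRotaBaxterOperator (0 : k) P
  b_ne_zero : b ≠ 0
  mixed : ∀ x : R, d (P x) = P (d x) + b • P x

/-- Differential Rota-Baxter bracketed words on `X`, written out letter by letter. The letters are
the elements `D^n(x)` of `Δ(X)` and the brackets `P(w)` of words `w`; a word is a nonempty string of
letters in which no two brackets are adjacent. Grouping the maximal runs of letters from `Δ(X)`
gives exactly the standard decomposition of the word into factors lying alternately in the free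
semigroup `S(Δ(X))` and in `P(𝔛_∞)`, so that the family is the least fixed point of
`𝔛 = Λ(S(Δ(X)), 𝔛)`, the union of the sets `𝔛_n = Λ(𝔛_0, 𝔛_{n-1})` with `𝔛_0 = S(Δ(X))`.
The index is `true` if the first letter is a bracket and `false` if it is in `Δ(X)`. -/
inductive DRBWord (X : Type*) : Bool → Type _
  /-- the one-letter word `D^n(x)` -/
  | letter (x : X) (n : ℕ) : DRBWord X false
  /-- the word `D^n(x) w` -/
  | letterCons (x : X) (n : ℕ) {i : Bool} (w : DRBWord X i) : DRBWord X false
  /-- the one-letter word `P(w)` -/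
  | bracket {i : Bool} (w : DRBWord X i) : DRBWord X true
  /-- the word `P(w) v`, where `v` begins with a letter from `Δ(X)` -/
  | bracketCons {i : Bool} (w : DRBWord X i) (v : DRBWord X false) : DRBWord X true

/-- The set `𝔛_∞` of all differential Rota-Baxter bracketed words on `X`. -/
abbrev DRBW (X : Type*) : Type _ := Σ i : Bool, DRBWord X i

namespace DRBWord

variable (k : Type*) [CommRing k] {X : Type*}

/-- Linear extension of a map of words. -/
noncomputable def mapWords {S T : Type*} (f : S → T) (p : S →₀ k) : T →₀ k := Finsupp.mapDomain f p

/-- The product `u ⋄ v` of two words (weight `0`). Only the last letter of `u` and the first letter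
of `v` interact: if they are `P(w)` and `P(w')`, then
`P(w) ⋄ P(w') = P(w ⋄ P(w')) + P(P(w) ⋄ w')`, the remaining letters being concatenated on both
sides; otherwise `u ⋄ v` is the concatenation `uv`. All words occurring in `u ⋄ v` begin with a
letter of the same kind as `u`, which is recorded in the type. -/
noncomputable def diamond : {i j : Bool} → DRBWord X i → DRBWord X j → (DRBWord X i →₀ k)
  | _, _, letter x n, v => Finsupp.single (letterCons x n v) 1
  | _, _, letterCons x n u, v => mapWords k (letterCons x n) (diamond u v)
  | _, _, bracketCons w u, v => mapWords k (bracketCons w) (diamond u v)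
  | _, _, bracket w, letter x n => Finsupp.single (bracketCons w (letter x n)) 1
  | _, _, bracket w, letterCons x n v => Finsupp.single (bracketCons w (letterCons x n v)) 1
  | _, _, bracket w, bracket w' =>
      mapWords k (fun z => bracket z) (diamond w (bracket w')) +
        mapWords k (fun z => bracket z) (diamond (bracket w) w')
  | _, _, bracket w, bracketCons w' v =>
      mapWords k (fun z => bracketCons z v) (diamond w (bracket w')) +
        mapWords k (fun z => bracketCons z v) (diamond (bracket w) w')
  termination_by _ _ u v => sizeOf u + sizeOf v

/-- The derivation `d_X` on words: `d(D^n(x)) = D^{n+1}(x)`, `d(P(w)) = P(d(w)) + b P(w)`, and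
`d(u₁ u₂ ⋯ u_m) = d(u₁) u₂ ⋯ u_m + u₁ d(u₂ ⋯ u_m)`. -/
noncomputable def deriv (b : k) : {i : Bool} → DRBWord X i → (DRBWord X i →₀ k)
  | _, letter x n => Finsupp.single (letter x (n + 1)) 1
  | _, letterCons x n w =>
      Finsupp.single (letterCons x (n + 1) w) 1 + mapWords k (letterCons x n) (deriv b w)
  | _, bracket w =>
      mapWords k (fun z => bracket z) (deriv b w) + b • Finsupp.single (bracket w) 1
  | _, bracketCons w v =>
      (mapWords k (fun z => bracketCons z v) (deriv b w) + b • Finsupp.single (bracketCons w v) 1) +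
        mapWords k (bracketCons w) (deriv b v)

end DRBWord

/-- The free `k`-module `k𝔛_∞` on the set of differential Rota-Baxter bracketed words on `X`. -/
def ShaNC (k : Type*) [CommRing k] (X : Type*) : Type _ := DRBW X →₀ k

namespace ShaNC

variable (k : Type*) [CommRing k] (X : Type*)

noncomputable instance : AddCommGroup (ShaNC k X) := inferInstanceAs (AddCommGroup (DRBW X →₀ k))

noncomputable instance : Module k (ShaNC k X) := inferInstanceAs (Module k (DRBW X →₀ k))

/-- The basis element of `k𝔛_∞` given by a word. -/
noncomputable def ofWord (u : DRBW X) : ShaNC k X := (Finsupp.single u 1 : DRBW X →₀ k)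

/-- The linear map out of `k𝔛_∞` with prescribed values on words. -/
noncomputable def lift {M : Type*} [AddCommGroup M] [Module k M] (f : DRBW X → M) :
    ShaNC k X →ₗ[k] M :=
  Finsupp.linearCombination k f

/-- The inclusion into `k𝔛_∞` of the span of the words with a given kind of first letter. -/
noncomputable def incl (i : Bool) (p : DRBWord X i →₀ k) : ShaNC k X :=
  (Finsupp.mapDomain (Sigma.mk i) p : DRBW X →₀ k)

/-- The bilinear extension of `⋄` to `k𝔛_∞`. -/
noncomputable def mulLin : ShaNC k X →ₗ[k] ShaNC k X →ₗ[k] ShaNC k X :=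
  lift k X fun u => lift k X fun v => incl k X u.1 (DRBWord.diamond k u.2 v.2)

noncomputable instance : Mul (ShaNC k X) := ⟨fun p q => mulLin k X p q⟩

noncomputable instance : NonUnitalNonAssocRing (ShaNC k X) :=
  { (inferInstance : AddCommGroup (ShaNC k X)), (inferInstance : Mul (ShaNC k X)) with
    left_distrib := fun p q r => map_add (mulLin k X p) q r
    right_distrib := fun p q r => LinearMap.map_add₂ (mulLin k X) p q r
    zero_mul := fun p => LinearMap.map_zero₂ (mulLin k X) p
    mul_zero := fun p => map_zero (mulLin k X p) }

/-- The linear operator `P_𝔛` with `P_𝔛(u) = P(u)` on words. -/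
noncomputable def opP : ShaNC k X →ₗ[k] ShaNC k X :=
  lift k X fun u => ofWord k X ⟨true, DRBWord.bracket u.2⟩

/-- The linear operator `d_X` for the parameter `b`. -/
noncomputable def opD (b : k) : ShaNC k X →ₗ[k] ShaNC k X :=
  lift k X fun u => incl k X u.1 (DRBWord.deriv k b u.2)

/-- The map `j_X : X → k𝔛_∞`. -/
noncomputable def j (x : X) : ShaNC k X := ofWord k X ⟨false, DRBWord.letter x 0⟩

end ShaNC

/-! Every word factors inside the algebra: prefixing a letter is left multiplication by it, and
`P(w)v` is `P(w) ⋄ v` because `v` starts in `Δ(X)` and nothing reacts at the junction. So each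
recursive clause defining `⋄` and `d_X` becomes an identity between elements of `k𝔛_∞`, linear in
every argument.

With these identities, associativity, the Leibniz rule and multiplicativity of the evaluation map
are each proved on words by induction on total size. Reassociation handles every case except
adjacent brackets. There both sides are expanded by `opP_mul_opP`, which is the Rota-Baxter
identity, and the induction hypotheses match the terms under `P`; for the Leibniz rule the terms in
`b` must also balance.

Freeness follows since every word is built from `X` by products, `d_X` and `P_𝔛`. This determines a
homomorphism on the basis, and the same recipe defines one. -/

@[simp]
theorem DRBWord.sizeOf_pos {X : Type*} {i : Bool} (w : DRBWord X i) : 0 < sizeOf w := by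
  cases w <;> simp

namespace ShaNC

/-! ### Words as a basis, and linear induction -/

section Basis

variable (k : Type*) [CommRing k] {X : Type*}

/-- The basis element of `k𝔛_∞` given by a word with a given kind of first letter. -/
noncomputable def word {i : Bool} (w : DRBWord X i) : ShaNC k X := ofWord k X ⟨i, w⟩

/-- The span of the words whose first letter is in `Δ(X)`. -/
noncomputable def letterFirst (X : Type*) : Submodule k (ShaNC k X) :=
  Submodule.span k (Set.range fun w : DRBWord X false => word k w)

variable {k}

@[simp]
theorem lift_word {M : Type*} [AddCommGroup M] [Module k M] (f : DRBW X → M) {i : Bool}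
    (w : DRBWord X i) : lift k X f (word k w) = f ⟨i, w⟩ := by
  refine (Finsupp.linearCombination_single k (1 : k) (⟨i, w⟩ : DRBW X)).trans ?_
  exact one_smul k _

theorem span_range_word :
    Submodule.span k (Set.range fun u : DRBW X => word k u.2) = ⊤ := by
  rw [eq_top_iff]
  rintro p -
  refine Finsupp.induction_linear (motive := fun p : ShaNC k X =>
    p ∈ Submodule.span k (Set.range fun u : DRBW X => word k u.2)) p
    (Submodule.zero_mem _) (fun p q hp hq => Submodule.add_mem _ hp hq) fun u c => ?_
  have h : (Finsupp.single u c : DRBW X →₀ k) = c • Finsupp.single u (1 : k) := by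
    rw [Finsupp.smul_single, smul_eq_mul, mul_one]
  exact h ▸ Submodule.smul_mem _ c (Submodule.subset_span ⟨u, rfl⟩)

/-- A property of elements of `k𝔛_∞` that is linear holds if it holds for words. -/
@[elab_as_elim]
theorem induction_word {p : ShaNC k X → Prop} (a : ShaNC k X)
    (hw : ∀ (i : Bool) (w : DRBWord X i), p (word k w)) (h0 : p 0)
    (hadd : ∀ a c, p a → p c → p (a + c)) (hsmul : ∀ (r : k) (a), p a → p (r • a)) : p a := by
  have ha : a ∈ Submodule.span k (Set.range fun u : DRBW X => word k u.2) := by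
    rw [span_range_word]; trivial
  induction ha using Submodule.span_induction with
  | mem x hx => obtain ⟨u, rfl⟩ := hx; exact hw u.1 u.2
  | zero => exact h0
  | add x y _ _ hx hy => exact hadd x y hx hy
  | smul r x _ hx => exact hsmul r x hx

@[elab_as_elim]
theorem letterFirst_induction {p : ShaNC k X → Prop} (a : ShaNC k X)
    (ha : a ∈ letterFirst k X)
    (hw : ∀ w : DRBWord X false, p (word k w)) (h0 : p 0)
    (hadd : ∀ a c, p a → p c → p (a + c)) (hsmul : ∀ (r : k) (a), p a → p (r • a)) : p a := by
  induction ha using Submodule.span_induction with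
  | mem x hx => obtain ⟨u, rfl⟩ := hx; exact hw u
  | zero => exact h0
  | add x y _ _ hx hy => exact hadd x y hx hy
  | smul r x _ hx => exact hsmul r x hx

theorem word_mem_letterFirst (w : DRBWord X false) : word k w ∈ letterFirst k X :=
  Submodule.subset_span ⟨w, rfl⟩

@[simp]
theorem incl_single (i : Bool) (w : DRBWord X i) :
    incl k X i (Finsupp.single w 1) = word k w :=
  Finsupp.mapDomain_single

@[simp]
theorem incl_add (i : Bool) (p q : DRBWord X i →₀ k) :
    incl k X i (p + q) = incl k X i p + incl k X i q :=
  Finsupp.mapDomain_add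

@[simp]
theorem incl_smul (i : Bool) (c : k) (p : DRBWord X i →₀ k) :
    incl k X i (c • p) = c • incl k X i p :=
  Finsupp.mapDomain_smul c p

@[simp]
theorem incl_zero (i : Bool) : incl k X i (0 : DRBWord X i →₀ k) = 0 :=
  Finsupp.mapDomain_zero

theorem incl_single_eq_smul (i : Bool) (w : DRBWord X i) (c : k) :
    incl k X i (Finsupp.single w c) = c • word k w := by
  rw [← incl_single, ← incl_smul]; simp

/-- The bridge from word recursion to algebra: a relabelling of words in a clause of `diamond` or
`deriv` is replaced by a linear operator on `k𝔛_∞`, such as `opP` or a multiplication. -/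
theorem incl_mapWords {i j : Bool} (f : DRBWord X i → DRBWord X j)
    (T : ShaNC k X →ₗ[k] ShaNC k X) (h : ∀ w, T (word k w) = word k (f w))
    (p : DRBWord X i →₀ k) :
    incl k X j (DRBWord.mapWords k f p) = T (incl k X i p) := by
  induction p using Finsupp.induction_linear with
  | zero => simp [DRBWord.mapWords]
  | add p q hp hq =>
    rw [DRBWord.mapWords] at *
    simp only [Finsupp.mapDomain_add, incl_add, map_add]
    exact congrArg₂ _ hp hq
  | single w c =>
    simp [DRBWord.mapWords, incl_single_eq_smul, h]

theorem incl_false_mem (p : DRBWord X false →₀ k) : incl k X false p ∈ letterFirst k X := by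
  induction p using Finsupp.induction_linear with
  | zero => simp
  | add p q hp hq => rw [incl_add]; exact Submodule.add_mem _ hp hq
  | single w c =>
    rw [incl_single_eq_smul]; exact Submodule.smul_mem _ _ (word_mem_letterFirst w)

instance : IsScalarTower k (ShaNC k X) (ShaNC k X) :=
  ⟨fun c p q => LinearMap.map_smul₂ (mulLin k X) c p q⟩

instance : SMulCommClass k (ShaNC k X) (ShaNC k X) :=
  ⟨fun c p q => ((mulLin k X p).map_smul c q).symm⟩

theorem mulLin_apply (p q : ShaNC k X) : mulLin k X p q = p * q := rfl

theorem word_mul_word {i j : Bool} (u : DRBWord X i) (v : DRBWord X j) :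
    word k u * word k v = incl k X i (DRBWord.diamond k u v) := by
  rw [← mulLin_apply, mulLin, lift_word, lift_word]

end Basis

/-! ### Rota-Baxter identity and associativity -/

section Structure

variable {k : Type*} [CommRing k] {X : Type*}

@[simp]
theorem opP_word {i : Bool} (w : DRBWord X i) : opP k X (word k w) = word k (.bracket w) := by
  rw [opP, lift_word]; rfl

theorem word_letterCons (x : X) (n : ℕ) {i : Bool} (w : DRBWord X i) :
    word k (.letterCons x n w) = word k (.letter x n) * word k w := by
  rw [word_mul_word, DRBWord.diamond, incl_single]

theorem word_bracketCons {i : Bool} (w : DRBWord X i) (v : DRBWord X false) :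
    word k (.bracketCons w v) = opP k X (word k w) * word k v := by
  rw [opP_word, word_mul_word]
  cases v <;> rw [DRBWord.diamond, incl_single]

theorem letter_mul_mul (x : X) (n : ℕ) (a c : ShaNC k X) :
    (word k (.letter x n) * a) * c = word k (.letter x n) * (a * c) := by
  refine induction_word a (fun i u => ?_) (by simp)
    (fun a a' h h' => by simp only [mul_add, add_mul, h, h'])
    fun r a h => by simp only [mul_smul_comm, smul_mul_assoc, h]
  refine induction_word c (fun j v => ?_) (by simp)
    (fun a a' h h' => by simp only [mul_add, h, h'])
    fun r a h => by simp only [mul_smul_comm, h]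
  rw [← word_letterCons, word_mul_word, word_mul_word, DRBWord.diamond]
  exact incl_mapWords _ (mulLin k X (word k (.letter x n)))
    (fun w => (word_letterCons x n w).symm) _

theorem mul_mem_letterFirst {a : ShaNC k X} (ha : a ∈ letterFirst k X) (c : ShaNC k X) :
    a * c ∈ letterFirst k X := by
  refine letterFirst_induction a ha (fun u => ?_) (by simp)
    (fun a a' h h' => by rw [add_mul]; exact Submodule.add_mem _ h h')
    fun r a h => by rw [smul_mul_assoc]; exact Submodule.smul_mem _ _ h
  refine induction_word c (fun j v => ?_) (by simp)
    (fun a a' h h' => by rw [mul_add]; exact Submodule.add_mem _ h h')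
    fun r a h => by rw [mul_smul_comm]; exact Submodule.smul_mem _ _ h
  rw [word_mul_word]
  exact incl_false_mem _

/-- The words of `c` keep the bracket away from `e`, so only the junction of `c` and `e` can react.
-/
theorem opP_mul_mul (a : ShaNC k X) {c : ShaNC k X} (hc : c ∈ letterFirst k X) (e : ShaNC k X) :
    (opP k X a * c) * e = opP k X a * (c * e) := by
  refine induction_word a (fun i w => ?_) (by simp)
    (fun a a' h h' => by simp only [map_add, add_mul, h, h'])
    fun r a h => by simp only [map_smul, smul_mul_assoc, h]
  refine letterFirst_induction c hc (fun u => ?_) (by simp)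
    (fun a a' h h' => by simp only [mul_add, add_mul, h, h'])
    fun r a h => by simp only [mul_smul_comm, smul_mul_assoc, h]
  refine induction_word e (fun j v => ?_) (by simp)
    (fun a a' h h' => by simp only [mul_add, h, h'])
    fun r a h => by simp only [mul_smul_comm, h]
  rw [← word_bracketCons, word_mul_word, word_mul_word, DRBWord.diamond]
  exact incl_mapWords _ (mulLin k X (opP k X (word k w)))
    (fun v => (word_bracketCons w v).symm) _

theorem opP_mul_opP (a c : ShaNC k X) :
    opP k X a * opP k X c = opP k X (a * opP k X c + opP k X a * c) := by
  refine induction_word a (fun i w => ?_) (by simp)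
    (fun a a' h h' => by simp only [map_add, add_mul, h, h']; abel)
    fun r a h => by simp only [map_smul, smul_mul_assoc, h, ← smul_add]
  refine induction_word c (fun j v => ?_) (by simp)
    (fun a a' h h' => by simp only [map_add, mul_add, h, h']; abel)
    fun r a h => by simp only [map_smul, mul_smul_comm, h, ← smul_add]
  simp only [opP_word, map_add]
  simp only [word_mul_word]
  rw [DRBWord.diamond, incl_add, incl_mapWords _ (opP k X) (fun w => opP_word w),
    incl_mapWords _ (opP k X) (fun w => opP_word w)]

/-- Two brackets react while the tail is carried along unchanged: this is the
`bracket`–`bracketCons` clause of `diamond`. -/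
theorem opP_mul_opP_mul (a c : ShaNC k X) {e : ShaNC k X} (he : e ∈ letterFirst k X) :
    opP k X a * (opP k X c * e) = (opP k X a * opP k X c) * e := by
  refine induction_word a (fun i w => ?_) (by simp)
    (fun a a' h h' => by simp only [map_add, add_mul, h, h'])
    fun r a h => by simp only [map_smul, smul_mul_assoc, h]
  refine induction_word c (fun j v => ?_) (by simp)
    (fun a a' h h' => by simp only [map_add, mul_add, add_mul, h, h'])
    fun r a h => by simp only [map_smul, mul_smul_comm, smul_mul_assoc, h]
  refine letterFirst_induction e he (fun t => ?_) (by simp)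
    (fun a a' h h' => by simp only [mul_add, h, h'])
    fun r a h => by simp only [mul_smul_comm, h]
  have hT : ∀ {l : Bool} (z : DRBWord X l), ((mulLin k X).flip (word k t) ∘ₗ opP k X) (word k z) =
      word k (.bracketCons z t) := fun z => (word_bracketCons z t).symm
  rw [opP_mul_opP, ← word_bracketCons, opP_word, opP_word, word_mul_word, word_mul_word,
    word_mul_word, DRBWord.diamond, incl_add, incl_mapWords _ _ hT, incl_mapWords _ _ hT,
    ← map_add]
  rfl

theorem mul_assoc_word {i j l : Bool} (u : DRBWord X i) (v : DRBWord X j) (t : DRBWord X l) :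
    (word k u * word k v) * word k t = word k u * (word k v * word k t) := by
  match i, j, l, u, v, t with
  | _, _, _, .letter x n, v, t => exact letter_mul_mul x n _ _
  | _, _, _, .letterCons x n u, v, t =>
    simp only [word_letterCons, letter_mul_mul, mul_assoc_word u v t]
  | _, _, _, .bracketCons w u, v, t =>
    have hu := word_mem_letterFirst (k := k) u
    rw [word_bracketCons, opP_mul_mul _ hu, opP_mul_mul _ (mul_mem_letterFirst hu _),
      opP_mul_mul _ hu, mul_assoc_word u v t]
  | _, false, _, .bracket w, v, t =>
    rw [← opP_word, opP_mul_mul _ (word_mem_letterFirst v)]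
  | _, _, _, .bracket w, .bracketCons w' v, t =>
    have hv := word_mem_letterFirst (k := k) v
    rw [← opP_word, word_bracketCons, opP_mul_opP_mul _ _ hv, opP_mul_mul _ hv,
      opP_mul_opP_mul _ _ (mul_mem_letterFirst hv _), opP_mul_opP, opP_mul_mul _ hv]
  | _, _, false, .bracket w, .bracket w', t =>
    rw [← opP_word, ← opP_word, opP_mul_opP_mul _ _ (word_mem_letterFirst t)]
  | _, _, _, .bracket w, .bracket w', .bracketCons w'' t =>
    have ht := word_mem_letterFirst (k := k) t
    -- Dropping the nonempty tail `t` lowers the total size.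
    have h := mul_assoc_word (.bracket w) (.bracket w') (.bracket w'')
    simp only [← opP_word] at h ⊢
    rw [word_bracketCons, opP_mul_opP_mul _ _ ht, opP_mul_opP (word k w') (word k w''),
      opP_mul_opP_mul _ _ ht, ← opP_mul_opP (word k w') (word k w''), ← h,
      opP_mul_opP (word k w) (word k w'), opP_mul_opP_mul _ _ ht]
  | _, _, _, .bracket w, .bracket w', .bracket w'' =>
    have h1 := mul_assoc_word w (.bracket w') (.bracket w'')
    have h2 := mul_assoc_word (.bracket w) w' (.bracket w'')
    have h3 := mul_assoc_word (.bracket w) (.bracket w') w''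
    simp only [← opP_word] at h1 h2 h3 ⊢
    -- Expand both sides to `P` of a sum, then fold the inner sums back into products of two
    -- brackets. What remains under `P` is three triple products, in each of which one of the three
    -- words has lost its bracket.
    rw [opP_mul_opP (word k w) (word k w'), opP_mul_opP (word k w') (word k w''),
      opP_mul_opP, opP_mul_opP, ← opP_mul_opP (word k w) (word k w'),
      ← opP_mul_opP (word k w') (word k w'')]
    simp only [add_mul, mul_add, map_add, h1, h2, h3]
    abel
  termination_by sizeOf u + sizeOf v + sizeOf t

theorem mul_assoc' (a c e : ShaNC k X) : (a * c) * e = a * (c * e) := by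
  refine induction_word a (fun i u => ?_) (by simp)
    (fun a a' h h' => by simp only [add_mul, h, h'])
    fun r a h => by simp only [smul_mul_assoc, h]
  refine induction_word c (fun j v => ?_) (by simp)
    (fun a a' h h' => by simp only [mul_add, add_mul, h, h'])
    fun r a h => by simp only [mul_smul_comm, smul_mul_assoc, h]
  refine induction_word e (fun l t => ?_) (by simp)
    (fun a a' h h' => by simp only [mul_add, h, h'])
    fun r a h => by simp only [mul_smul_comm, h]
  exact mul_assoc_word u v t

end Structure

/-! ### Leibniz rule and the mixed relation -/

section Derivation

variable {k : Type*} [CommRing k] (b : k) {X : Type*}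

theorem opD_word {i : Bool} (w : DRBWord X i) :
    opD k X b (word k w) = incl k X i (DRBWord.deriv k b w) := by
  rw [opD, lift_word]

theorem opD_letter (x : X) (n : ℕ) :
    opD k X b (word k (.letter x n)) = word k (.letter x (n + 1)) := by
  rw [opD_word, DRBWord.deriv, incl_single]

theorem opD_letter_mul (x : X) (n : ℕ) (a : ShaNC k X) :
    opD k X b (word k (.letter x n) * a) =
      opD k X b (word k (.letter x n)) * a + word k (.letter x n) * opD k X b a := by
  refine induction_word a (fun i u => ?_) (by simp)
    (fun a a' h h' => by simp only [mul_add, map_add, h, h']; abel)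
    fun r a h => by simp only [mul_smul_comm, map_smul, h, smul_add]
  rw [← word_letterCons, opD_word, opD_letter, DRBWord.deriv, incl_add, incl_single,
    word_letterCons, opD_word, incl_mapWords _ (mulLin k X (word k (.letter x n)))
    (fun w => (word_letterCons x n w).symm), mulLin_apply]

theorem opD_opP (a : ShaNC k X) :
    opD k X b (opP k X a) = opP k X (opD k X b a) + b • opP k X a := by
  refine induction_word a (fun i u => ?_) (by simp)
    (fun a a' h h' => by simp only [map_add, h, h', smul_add]; abel)
    fun r a h => by simp only [map_smul, h, smul_add, smul_comm r b]
  rw [opP_word, opD_word, opD_word, DRBWord.deriv, incl_add, incl_smul, incl_single,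
    incl_mapWords _ (opP k X) (fun w => opP_word w)]

theorem opD_opP_mul (a : ShaNC k X) {c : ShaNC k X} (hc : c ∈ letterFirst k X) :
    opD k X b (opP k X a * c) =
      opD k X b (opP k X a) * c + opP k X a * opD k X b c := by
  refine induction_word a (fun i w => ?_) (by simp)
    (fun a a' h h' => by simp only [add_mul, map_add, h, h']; abel)
    fun r a h => by simp only [smul_mul_assoc, map_smul, h, smul_add]
  refine letterFirst_induction c hc (fun v => ?_) (by simp)
    (fun a a' h h' => by simp only [mul_add, map_add, h, h']; abel)
    fun r a h => by simp only [mul_smul_comm, map_smul, h, smul_add]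
  have hS : ∀ z : DRBWord X i, ((mulLin k X).flip (word k v) ∘ₗ opP k X) (word k z) =
      word k (.bracketCons z v) := fun z => (word_bracketCons z v).symm
  have h1 := incl_mapWords (fun z => DRBWord.bracketCons z v) _ hS (DRBWord.deriv k b w)
  have hT : ∀ z : DRBWord X false,
      mulLin k X (opP k X (word k w)) (word k z) = word k (.bracketCons w z) :=
    fun z => (word_bracketCons w z).symm
  have h2 := incl_mapWords (DRBWord.bracketCons w) _ hT (DRBWord.deriv k b v)
  rw [LinearMap.comp_apply, LinearMap.flip_apply, mulLin_apply] at h1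
  rw [mulLin_apply] at h2
  rw [← word_bracketCons, opD_opP, opD_word, opD_word, opD_word, DRBWord.deriv, incl_add, incl_add,
    incl_smul, incl_single, word_bracketCons, h1, h2, add_mul, smul_mul_assoc]

theorem opD_word_mul_word {i j : Bool} (u : DRBWord X i) (v : DRBWord X j) :
    opD k X b (word k u * word k v) =
      opD k X b (word k u) * word k v + word k u * opD k X b (word k v) := by
  match i, j, u, v with
  | _, _, .letter x n, v => exact opD_letter_mul b x n _
  | _, _, .letterCons x n u, v =>
    simp only [word_letterCons, mul_assoc', opD_letter_mul, opD_word_mul_word u v, add_mul,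
      mul_add, add_assoc]
  | _, _, .bracketCons w u, v =>
    have hu := word_mem_letterFirst (k := k) u
    rw [word_bracketCons, mul_assoc', opD_opP_mul b _ (mul_mem_letterFirst hu _),
      opD_opP_mul b _ hu, opD_word_mul_word u v]
    simp only [mul_assoc', add_mul, mul_add, add_assoc]
  | _, false, .bracket w, v =>
    rw [← opP_word, opD_opP_mul b _ (word_mem_letterFirst v)]
  | _, _, .bracket w, .bracketCons w' v =>
    have hv := word_mem_letterFirst (k := k) v
    have h := opD_word_mul_word (.bracket w) (.bracket w')
    simp only [← opP_word] at h ⊢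
    -- The product of the two brackets is itself a value of `opP`, so the rule for a bracket
    -- followed by a `Δ(X)`-tail applies to it.
    rw [word_bracketCons, ← mul_assoc', opP_mul_opP, opD_opP_mul b _ hv, opD_opP_mul b _ hv,
      ← opP_mul_opP, h]
    simp only [mul_assoc', add_mul, mul_add, add_assoc]
  | _, _, .bracket w, .bracket w' =>
    have h1 := opD_word_mul_word w (.bracket w')
    have h2 := opD_word_mul_word (.bracket w) w'
    simp only [← opP_word] at h1 h2 ⊢
    rw [opP_mul_opP, opD_opP, map_add, h1, h2]
    -- The terms in `b` balance: on the left one `b • P(w)P(w')` comes from the outer `P` and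
    -- another from the two inner brackets; on the right each factor gives one.
    simp only [opD_opP, add_mul, mul_add, map_add, smul_mul_assoc, mul_smul_comm, opP_mul_opP,
      smul_add, map_smul]
    abel
  termination_by sizeOf u + sizeOf v

theorem opD_mul (a c : ShaNC k X) :
    opD k X b (a * c) = opD k X b a * c + a * opD k X b c := by
  refine induction_word a (fun i u => ?_) (by simp)
    (fun a a' h h' => by simp only [add_mul, map_add, h, h']; abel)
    fun r a h => by simp only [smul_mul_assoc, map_smul, h, smul_add]
  refine induction_word c (fun j v => ?_) (by simp)
    (fun a a' h h' => by simp only [mul_add, map_add, h, h']; abel)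
    fun r a h => by simp only [mul_smul_comm, map_smul, h, smul_add]
  exact opD_word_mul_word b u v

theorem isParaDiffRotaBaxterIII (hb : b ≠ 0) :
    IsParaDiffRotaBaxterIII b (opD k X b) (opP k X) where
  smul_mul := smul_mul_assoc
  mul_smul := fun c x y => mul_smul_comm c x y
  mul_assoc := mul_assoc'
  differential := fun x y => by rw [opD_mul, zero_smul, add_zero]
  rotaBaxter := fun x y => by rw [opP_mul_opP, zero_smul, add_zero, map_add, add_comm]
  b_ne_zero := hb
  mixed := opD_opP b

end Derivation

theorem j_injective (k : Type*) [CommRing k] [Nontrivial k] (X : Type*) :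
    Function.Injective (j k X) := by
  intro x y h
  have h' := Finsupp.single_left_injective (one_ne_zero (α := k)) h
  simpa using h'

/-! ### Evaluation and the universal property -/

section Universal

variable {k : Type*} [CommRing k] {X R : Type*} [NonUnitalRing R] [Module k R]

/-- The value on a word of the homomorphism out of `k𝔛_∞` extending `f`. -/
def evalWord (d P : R →ₗ[k] R) (f : X → R) : {i : Bool} → DRBWord X i → R
  | _, .letter x n => d^[n] (f x)
  | _, .letterCons x n w => d^[n] (f x) * evalWord d P f w
  | _, .bracket w => P (evalWord d P f w)
  | _, .bracketCons w v => P (evalWord d P f w) * evalWord d P f v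

/-- The linear map out of `k𝔛_∞` with values `evalWord`. -/
noncomputable def evalLin (d P : R →ₗ[k] R) (f : X → R) : ShaNC k X →ₗ[k] R :=
  lift k X fun u => evalWord d P f u.2

/-- Uniqueness: the factorizations, with `D^n(x)` obtained by iterating `d_X` on `x`, force the
value on every word. -/
theorem hom_word_eq_evalWord {d P : R →ₗ[k] R} {f : X → R} {b : k} {F : ShaNC k X →ₙₐ[k] R}
    (hd : ∀ u, F (opD k X b u) = d (F u)) (hP : ∀ u, F (opP k X u) = P (F u))
    (hj : ∀ x, F (j k X x) = f x) {i : Bool} (w : DRBWord X i) :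
    F (word k w) = evalWord d P f w := by
  have hl : ∀ (x : X) (n : ℕ), F (word k (.letter x n)) = d^[n] (f x) := fun x n => by
    induction n with
    | zero => exact hj x
    | succ n ih => rw [← opD_letter b, hd, ih, Function.iterate_succ_apply']
  induction w with
  | letter x n => exact hl x n
  | letterCons x n w ih => rw [word_letterCons, map_mul, hl, ih, evalWord]
  | bracket w ih => rw [← opP_word, hP, ih, evalWord]
  | bracketCons w v ihw ihv => rw [word_bracketCons, map_mul, hP, ihw, ihv, evalWord]

variable (d P : R →ₗ[k] R) (f : X → R)

theorem evalLin_word {i : Bool} (w : DRBWord X i) :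
    evalLin d P f (word k w) = evalWord d P f w := by
  rw [evalLin, lift_word]

theorem evalLin_opP (a : ShaNC k X) : evalLin d P f (opP k X a) = P (evalLin d P f a) := by
  refine induction_word a (fun i u => ?_) (by simp)
    (fun a a' h h' => by simp only [map_add, h, h'])
    fun r a h => by simp only [map_smul, h]
  rw [opP_word, evalLin_word, evalLin_word, evalWord]

variable [SMulCommClass k R R]

theorem evalLin_letter_mul (x : X) (n : ℕ) (a : ShaNC k X) :
    evalLin d P f (word k (.letter x n) * a) = d^[n] (f x) * evalLin d P f a := by
  refine induction_word a (fun i u => ?_) (by simp)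
    (fun a a' h h' => by simp only [map_add, mul_add, h, h'])
    fun r a h => by simp only [map_smul, mul_smul_comm, h]
  rw [← word_letterCons, evalLin_word, evalLin_word, evalWord]

variable [IsScalarTower k R R]

theorem evalLin_opP_mul (a : ShaNC k X) {c : ShaNC k X} (hc : c ∈ letterFirst k X) :
    evalLin d P f (opP k X a * c) = P (evalLin d P f a) * evalLin d P f c := by
  refine induction_word a (fun i w => ?_) (by simp)
    (fun a a' h h' => by simp only [map_add, add_mul, h, h'])
    fun r a h => by simp only [map_smul, smul_mul_assoc, h]
  refine letterFirst_induction c hc (fun v => ?_) (by simp)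
    (fun a a' h h' => by simp only [map_add, mul_add, h, h'])
    fun r a h => by simp only [map_smul, mul_smul_comm, h]
  rw [← word_bracketCons, evalLin_word, evalLin_word, evalLin_word, evalWord]

variable {d P}

/-- Reacting brackets are the only obstruction, and the Rota-Baxter identity of `R` mirrors that
reaction. -/
theorem evalLin_word_mul_word (hP : IsRotaBaxterOperator (0 : k) P) {i j : Bool}
    (u : DRBWord X i) (v : DRBWord X j) :
    evalLin d P f (word k u * word k v) =
      evalLin d P f (word k u) * evalLin d P f (word k v) := by
  match i, j, u, v with
  | _, _, .letter x n, v => rw [evalLin_letter_mul, evalLin_word d P f (.letter x n), evalWord]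
  | _, _, .letterCons x n u, v =>
    rw [word_letterCons, mul_assoc', evalLin_letter_mul, evalLin_letter_mul,
      evalLin_word_mul_word hP u v, mul_assoc]
  | _, _, .bracketCons w u, v =>
    have hu := word_mem_letterFirst (k := k) u
    rw [word_bracketCons, mul_assoc', evalLin_opP_mul d P f _ (mul_mem_letterFirst hu _),
      evalLin_opP_mul d P f _ hu, evalLin_word_mul_word hP u v, mul_assoc]
  | _, false, .bracket w, v =>
    rw [← opP_word, evalLin_opP_mul d P f _ (word_mem_letterFirst v), evalLin_opP]
  | _, _, .bracket w, .bracketCons w' v =>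
    have hv := word_mem_letterFirst (k := k) v
    have h := evalLin_word_mul_word hP (.bracket w) (.bracket w')
    simp only [← opP_word] at h ⊢
    rw [word_bracketCons, ← mul_assoc', opP_mul_opP, evalLin_opP_mul d P f _ hv, ← evalLin_opP,
      ← opP_mul_opP, h, evalLin_opP_mul d P f _ hv, evalLin_opP, evalLin_opP, mul_assoc]
  | _, _, .bracket w, .bracket w' =>
    have h1 := evalLin_word_mul_word hP w (.bracket w')
    have h2 := evalLin_word_mul_word hP (.bracket w) w'
    simp only [← opP_word] at h1 h2 ⊢
    rw [opP_mul_opP, evalLin_opP, map_add, h1, h2, evalLin_opP, evalLin_opP, hP, zero_smul,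
      add_zero, map_add, add_comm]
  termination_by sizeOf u + sizeOf v

theorem evalLin_mul (hP : IsRotaBaxterOperator (0 : k) P) (a c : ShaNC k X) :
    evalLin d P f (a * c) = evalLin d P f a * evalLin d P f c := by
  refine induction_word a (fun i u => ?_) (by simp)
    (fun a a' h h' => by simp only [add_mul, map_add, h, h'])
    fun r a h => by simp only [smul_mul_assoc, map_smul, h]
  refine induction_word c (fun j v => ?_) (by simp)
    (fun a a' h h' => by simp only [mul_add, map_add, h, h'])
    fun r a h => by simp only [mul_smul_comm, map_smul, h]
  exact evalLin_word_mul_word f hP u v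

theorem evalLin_opD_word {b : k} (h : IsParaDiffRotaBaxterIII b d P) {i : Bool}
    (w : DRBWord X i) :
    evalLin d P f (opD k X b (word k w)) = d (evalLin d P f (word k w)) := by
  have hd : ∀ x y : R, d (x * y) = d x * y + x * d y := fun x y => by
    rw [h.differential, zero_smul, add_zero]
  have hl : ∀ (x : X) (n : ℕ), evalLin d P f (opD k X b (word k (.letter x n))) =
      d (evalLin d P f (word k (.letter x n))) := fun x n => by
    rw [opD_letter, evalLin_word, evalLin_word, evalWord, evalWord, Function.iterate_succ_apply']
  induction w with
  | letter x n => exact hl x n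
  | letterCons x n w ih =>
    rw [word_letterCons, opD_mul, map_add, evalLin_mul f h.rotaBaxter, evalLin_mul f h.rotaBaxter,
      evalLin_mul f h.rotaBaxter, hd, hl, ih]
  | bracket w ih =>
    rw [← opP_word, opD_opP, map_add, map_smul, evalLin_opP, evalLin_opP, ih, h.mixed]
  | bracketCons w v ihw ihv =>
    rw [word_bracketCons, opD_mul, map_add, evalLin_mul f h.rotaBaxter,
      evalLin_mul f h.rotaBaxter, evalLin_mul f h.rotaBaxter, hd, opD_opP, map_add, map_smul,
      evalLin_opP, evalLin_opP, ihw, ihv, h.mixed]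

theorem evalLin_opD {b : k} (h : IsParaDiffRotaBaxterIII b d P) (a : ShaNC k X) :
    evalLin d P f (opD k X b a) = d (evalLin d P f a) := by
  refine induction_word a (fun i u => evalLin_opD_word f h u) (by simp)
    (fun a a' h h' => by simp only [map_add, h, h'])
    fun r a h => by simp only [map_smul, h]

/-- The homomorphism of algebras out of `k𝔛_∞` extending `f`. -/
noncomputable def eval (hP : IsRotaBaxterOperator (0 : k) P) (d : R →ₗ[k] R) (f : X → R) :
    ShaNC k X →ₙₐ[k] R where
  toFun := evalLin d P f
  map_smul' := map_smul (evalLin d P f)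
  map_zero' := map_zero (evalLin d P f)
  map_add' := map_add (evalLin d P f)
  map_mul' := evalLin_mul f hP

end Universal

end ShaNC

theorem mainTheorem2 (k : Type u) [CommRing k] (b : k) (hb : b ≠ 0) (X : Type v) :
    IsParaDiffRotaBaxterIII b (ShaNC.opD k X b) (ShaNC.opP k X) ∧
    Function.Injective (ShaNC.j k X) ∧
    ∀ (R : Type w) [NonUnitalRing R] [Module k R] [IsScalarTower k R R] [SMulCommClass k R R]
      (d P : R →ₗ[k] R), IsParaDiffRotaBaxterIII b d P →
      ∀ f : X → R, ∃! F : ShaNC k X →ₙₐ[k] R,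
        (∀ u, F (ShaNC.opD k X b u) = d (F u)) ∧
        (∀ u, F (ShaNC.opP k X u) = P (F u)) ∧
        ∀ x, F (ShaNC.j k X x) = f x := by
  -- Injectivity of `j` needs this: over the zero ring all basis elements coincide.
  have : Nontrivial k := nontrivial_of_ne b 0 hb
  refine ⟨ShaNC.isParaDiffRotaBaxterIII b hb, ShaNC.j_injective k X, ?_⟩
  intro R _ _ _ _ d P h f
  refine ⟨ShaNC.eval h.rotaBaxter d f, ⟨ShaNC.evalLin_opD f h, ShaNC.evalLin_opP d P f,
    fun x => ShaNC.evalLin_word d P f (.letter x 0)⟩, ?_⟩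
  rintro F ⟨hd, hP, hj⟩
  ext a
  refine ShaNC.induction_word a (fun i w => ?_) (by simp only [map_zero])
    (fun a c ha hc => by simp only [map_add, ha, hc]) fun r a ha => by simp only [map_smul, ha]
  exact (ShaNC.hom_word_eq_evalWord hd hP hj w).trans (ShaNC.evalLin_word d P f w).symm
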